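/- Let $P\subset\mathbb{R}^2$ be a finite set of $n\ge 2$ points (cities), and let an edge $ab$ between two cities have weight $|ab|^2$, the squared Euclidean distance. A tour is a closed tour that visits every city exactly once; its weight is the sum of the weights of its $n$ edges (for $n=2$ the tour uses the single edge twice). TSP$(2,2)$ asks for a tour of minimum weight $\mathrm{OPT}$. The geometric $T^3$-algorithm takes a minimum spanning tree (MST) $T$ of the complete graph on $P$ with respect to these weights and an edge $e$ of $T$, and returns $\textsc{CycleInCube}(T,e)$, where for a tree $T$ and an edge $e=u_1u_2$ of $T$ the procedure $\textsc{CycleInCube}(T,e)$ is defined recursively as follows. For $i=1,2$ let $T_i$ be the component of $T-e$ that contains $u_i$. If $|T_i|=1$, put $\Pi_i=\emptyset$ and $w_i=u_i$. Otherwise pick, among the edges of $T_i$ incident to $u_i$, an edge $e_i=u_iw_i$ that makes the smallest angle (in $[0,\pi]$) with $e$; if $|T_i|=2$, put $\Pi_i=e_i$, and if $|T_i|\ge 3$, put $\Pi_i=\textsc{CycleInCube}(T_i,e_i)-e_i$. Return $\Pi_1+e+\Pi_2+w_1w_2$. **Theorem.** The geometric $T^3$-algorithm is a $5$-approximation for TSP$(2,2)$.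 That is, an MST and an edge of it exist, and for every choice of the MST, of the start edge and of the way ties between angles are broken, the algorithm returns a tour through $P$, and the weight of this tour is at most $5\cdot\mathrm{OPT}$; it is in fact at most $5$ times the weight of the MST. Moreover, once the MST is given, the procedure takes at most $3n^2$ steps, where a call on a tree $T$ is charged $|T|$ steps for splitting $T-e$ into its components, one step for each edge examined in the choice of an $e_i$, one step for each edge of a returned cycle examined in order to remove $e_i$ from it, and two steps for adding $e$ and $w_1w_2$. -/

import Mathlib

namespace TSPSquared

variable {V : Type*}

/-- The weight `|ab|²` of the edge joining the cities `a` and `b`; city `v` sits at the point `p v`. -/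
noncomputable def edgeWeight (p : V → EuclideanSpace ℝ (Fin 2)) : Sym2 V → ℝ :=
  Sym2.lift ⟨fun a b => dist (p a) (p b) ^ 2, fun a b => by simp only [dist_comm]⟩

/-- Total weight of a multiset of edges. -/
noncomputable def weight (p : V → EuclideanSpace ℝ (Fin 2)) (M : Multiset (Sym2 V)) : ℝ :=
  (M.map (edgeWeight p)).sum

/-- A tour, written as the list of the cities in the order of visit: every city occurs exactly
once. After the last city the tour returns to the first one. -/
def IsTour (l : List V) : Prop := l.Nodup ∧ ∀ v, v ∈ l

/-- The edges of the closed tour `l`, including the edge from the last city back to the first. For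
two cities this is the edge between them, taken twice. -/
def tourEdges (l : List V) : Multiset (Sym2 V) :=
  (List.zipWith (fun a b => s(a, b)) l (l.rotate 1) : List (Sym2 V))

open Classical in
/-- Total weight of the edges of a graph on the cities. -/
noncomputable def graphWeight [Fintype V] (p : V → EuclideanSpace ℝ (Fin 2))
    (T : SimpleGraph V) : ℝ :=
  ∑ e ∈ T.edgeFinset, edgeWeight p e

/-- `T` is a minimum spanning tree of the complete graph on the cities, with edge weights
`|ab|²`. -/
def IsMST [Fintype V] (p : V → EuclideanSpace ℝ (Fin 2)) (T : SimpleGraph V) : Prop :=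
  T.IsTree ∧ ∀ T' : SimpleGraph V, T'.IsTree → graphWeight p T ≤ graphWeight p T'

/-- The connected component of `H` that contains the vertex `v`. -/
def component {T : SimpleGraph V} (H : T.Subgraph) (v : V) : T.Subgraph :=
  H.induce {x | H.spanningCoe.Reachable v x}

/-- For the edge `e` with endpoints `u 0` and `u 1`: the component of `H - e` that contains
`u i`. -/
def side {T : SimpleGraph V} (H : T.Subgraph) (u : Fin 2 → V) (i : Fin 2) : T.Subgraph :=
  component (H.deleteEdges {s(u 0, u 1)}) (u i)

/-- The geometric choice: `x w` is an edge of `H` at `x` that makes the smallest angle with the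
segment `x y`. Ties may be broken in any way. -/
def IsPick (p : V → EuclideanSpace ℝ (Fin 2)) {T : SimpleGraph V} (H : T.Subgraph)
    (x y w : V) : Prop :=
  H.Adj x w ∧ ∀ z, H.Adj x z →
    EuclideanGeometry.angle (p y) (p x) (p w) ≤ EuclideanGeometry.angle (p y) (p x) (p z)

/-- One pass through the loop body of the procedure, for the component `H` containing the endpoint
`x` of the current edge `x y`. Here `C` is the cycle returned by the recursive call on `H` and the
chosen edge `x w`, and `t` is the number of steps of that call (`C` and `t` matter only if there is
such a call, that is, in the third case). The pass produces the vertex `w`, the path `Q` (as a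
multiset of edges) and the number of steps: one for each edge at `x` that is examined for the choice
of `x w`, one for each edge of `C` that is examined in order to remove `x w`, and the steps of the
recursive call. -/
inductive LoopBody [DecidableEq V] (p : V → EuclideanSpace ℝ (Fin 2)) {T : SimpleGraph V}
    (H : T.Subgraph) (x y : V) (C : Multiset (Sym2 V)) (t : ℕ) :
    V → Multiset (Sym2 V) → ℕ → Prop
  | one (h : H.verts.ncard = 1) : LoopBody p H x y C t x 0 0
  | two {w : V} (h : H.verts.ncard = 2) (hw : IsPick p H x y w) :
      LoopBody p H x y C t w {s(x, w)} (H.neighborSet x).ncard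
  | more {w : V} (h : 2 < H.verts.ncard) (hw : IsPick p H x y w) :
      LoopBody p H x y C t w (C.erase s(x, w)) ((H.neighborSet x).ncard + C.card + t)

/-- `GeometricCycleInCube p H u M t`: the recursive procedure, applied to the tree `H` and its edge
`e` with endpoints `u 0` and `u 1`, can return the multiset of edges `M` after `t` steps. A call
takes one step for each vertex of `H` in order to split `H - e` into its two components, then the
steps of the two passes through the loop, and two steps for adding `e` and the edge `w 0, w 1`. -/
inductive GeometricCycleInCube [DecidableEq V] (p : V → EuclideanSpace ℝ (Fin 2))
    {T : SimpleGraph V} : T.Subgraph → (Fin 2 → V) → Multiset (Sym2 V) → ℕ → Prop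
  | mk {H : T.Subgraph} {u w : Fin 2 → V} {C Q : Fin 2 → Multiset (Sym2 V)} {t r : Fin 2 → ℕ}
      (edge : H.Adj (u 0) (u 1))
      (call : ∀ i, 2 < (side H u i).verts.ncard →
        GeometricCycleInCube p (side H u i) ![u i, w i] (C i) (t i))
      (body : ∀ i, LoopBody p (side H u i) (u i) (u i.rev) (C i) (t i) (w i) (Q i) (r i)) :
      GeometricCycleInCube p H u (Q 0 + {s(u 0, u 1)} + Q 1 + {s(w 0, w 1)})
        (H.verts.ncard + r 0 + r 1 + 2)

end TSPSquared

/-! The cycle comes from Hamiltonian paths on the two components of `H - e`, closed up by `e` and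
the shortcut `w 0, w 1`. The weight bound needs only that `T` is acyclic; minimality enters when a
tour, which connects all cities, is compared with the spanning tree inside it.

The factor 5 needs a stronger induction hypothesis (`weight_le_sub`): the cycle weighs at most `5
w(H) - |e|² - ‖s₀‖² - ‖s₁‖²`. Here `sᵢ` is a partial sum of edge vectors at `u i`: start with `e`
and keep adding the next greedily chosen edge while consecutive edges form an obtuse angle. The
slack `‖sᵢ‖²` pays for bad turns: the shortcut costs an extra `-2⟨e, eᵢ⟩` at each end, and
`LoopBody.exists_dominated` charges this to the change from `‖s‖²` to `‖S‖²`. After an obtuse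
smallest angle all remaining edges point away from `e`; `Dominated` records just enough of this to
avoid handling the whole sequence. -/

namespace TSPSquared

variable {V : Type*}

/-! ### Components of a tree after removing an edge -/

section Sides

variable {T : SimpleGraph V} {H : T.Subgraph} {u : Fin 2 → V}

theorem side_adj {i : Fin 2} {a b : V} :
    (side H u i).Adj a b ↔
      (H.deleteEdges {s(u 0, u 1)}).spanningCoe.Reachable (u i) a ∧
      (H.deleteEdges {s(u 0, u 1)}).spanningCoe.Reachable (u i) b ∧
      H.Adj a b ∧ s(a, b) ≠ s(u 0, u 1) := by
  simp [side, component, SimpleGraph.Subgraph.induce_adj]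

theorem mem_side_verts {i : Fin 2} {a : V} :
    a ∈ (side H u i).verts ↔
      (H.deleteEdges {s(u 0, u 1)}).spanningCoe.Reachable (u i) a := Iff.rfl

theorem self_mem_side_verts (i : Fin 2) : u i ∈ (side H u i).verts :=
  SimpleGraph.Reachable.refl _

/-- The neighbours of `u i` in its side are its neighbours in `H`, except for the other end. -/
theorem side_adj_self (i : Fin 2) (hu : u 0 ≠ u 1) {z : V} :
    (side H u i).Adj (u i) z ↔ H.Adj (u i) z ∧ z ≠ u i.rev := by
  have key : s(u i, z) ≠ s(u 0, u 1) ↔ z ≠ u i.rev := by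
    fin_cases i
    · simp [hu]
    · simp [hu.symm, Sym2.eq_swap]
  rw [side_adj, key]
  refine ⟨fun h => ⟨h.2.2.1, h.2.2.2⟩, fun h => ⟨.refl _, ?_, h.1, h.2⟩⟩
  exact SimpleGraph.Adj.reachable
    ((SimpleGraph.Subgraph.deleteEdges_adj ..).2 ⟨h.1, key.2 h.2⟩)

theorem mem_verts_of_mem_side (hu : H.Adj (u 0) (u 1)) {i : Fin 2} {a : V}
    (ha : a ∈ (side H u i).verts) : a ∈ H.verts := by
  have hi : u i ∈ H.verts := by
    fin_cases i
    · exact hu.fst_mem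
    · exact hu.snd_mem
  obtain ⟨p⟩ := mem_side_verts.1 ha
  cases p.reverse with
  | nil => exact hi
  | cons h _ => exact (SimpleGraph.Subgraph.deleteEdges_adj .. |>.1 h).1.fst_mem

/-- A common vertex would connect the ends of `e` without `e`, but every edge of an acyclic graph is
a bridge. -/
theorem disjoint_side_verts (hT : T.IsAcyclic) (hu : H.Adj (u 0) (u 1)) :
    Disjoint (side H u 0).verts (side H u 1).verts := by
  rw [Set.disjoint_left]
  intro a h0 h1
  have hb := SimpleGraph.isAcyclic_iff_forall_adj_isBridge.1 hT hu.adj_sub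
  rw [SimpleGraph.isBridge_iff] at hb
  refine hb ((SimpleGraph.Reachable.trans h0 h1.symm).mono ?_)
  intro x y h
  have h' := (SimpleGraph.Subgraph.deleteEdges_adj ..).1 h
  exact SimpleGraph.deleteEdges_adj.2 ⟨h'.1.adj_sub, h'.2⟩

/-- Any two vertices of `H` are joined by a walk in `H`. -/
def Joined (H : T.Subgraph) : Prop :=
  ∀ x ∈ H.verts, ∀ y ∈ H.verts, H.spanningCoe.Reachable x y

theorem joined_side (i : Fin 2) : Joined (side H u i) := by
  have key : ∀ x ∈ (side H u i).verts, (side H u i).spanningCoe.Reachable (u i) x := by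
    intro x hx
    have hx' := hx
    rw [mem_side_verts, SimpleGraph.reachable_iff_reflTransGen] at hx'
    induction hx' with
    | refl => exact .refl _
    | @tail b c hb hbc ih =>
      have hb' : (H.deleteEdges {s(u 0, u 1)}).spanningCoe.Reachable (u i) b :=
        (SimpleGraph.reachable_iff_reflTransGen _ _).2 hb
      refine (ih hb').trans (SimpleGraph.Adj.reachable ?_)
      exact ⟨hb', hx, hbc⟩
  exact fun x hx y hy => (key x hx).symm.trans (key y hy)

theorem side_verts_union (hH : Joined H) (hu : H.Adj (u 0) (u 1)) :
    (side H u 0).verts ∪ (side H u 1).verts = H.verts := by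
  refine Set.Subset.antisymm
    (Set.union_subset (fun _ => mem_verts_of_mem_side hu) (fun _ => mem_verts_of_mem_side hu)) ?_
  intro x hx
  have h := hH _ hu.fst_mem _ hx
  rw [SimpleGraph.reachable_iff_reflTransGen] at h
  clear hx
  induction h with
  | refl => exact .inl (self_mem_side_verts 0)
  | @tail b c _ hbc ih =>
    by_cases he : s(b, c) = s(u 0, u 1)
    · rcases Sym2.eq_iff.1 he with ⟨-, rfl⟩ | ⟨-, rfl⟩
      · exact .inr (self_mem_side_verts 1)
      · exact .inl (self_mem_side_verts 0)
    · have hadj : (H.deleteEdges {s(u 0, u 1)}).spanningCoe.Adj b c :=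
        (SimpleGraph.Subgraph.deleteEdges_adj ..).2 ⟨hbc, he⟩
      exact ih.imp (fun h => SimpleGraph.Reachable.trans h hadj.reachable)
        (fun h => SimpleGraph.Reachable.trans h hadj.reachable)

theorem ncard_side_add [Finite V] (hT : T.IsAcyclic) (hH : Joined H) (hu : H.Adj (u 0) (u 1)) :
    (side H u 0).verts.ncard + (side H u 1).verts.ncard = H.verts.ncard := by
  rw [← side_verts_union hH hu, Set.ncard_union_eq (disjoint_side_verts hT hu)]

theorem ncard_side_pos [Finite V] (i : Fin 2) : 0 < (side H u i).verts.ncard :=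
  (Set.ncard_pos).2 ⟨u i, self_mem_side_verts i⟩

theorem Joined.exists_adj (hH : Joined H) [Finite V] {x : V} (hx : x ∈ H.verts)
    (h : 1 < H.verts.ncard) : ∃ y, H.Adj x y := by
  obtain ⟨y, hy, hne⟩ := Set.exists_ne_of_one_lt_ncard h x
  obtain ⟨p⟩ := hH x hx y hy
  cases p with
  | nil => exact absurd rfl hne
  | cons h _ => exact ⟨_, h⟩

theorem exists_isPick [Finite V] (p : V → EuclideanSpace ℝ (Fin 2)) (hH : Joined H) {x y : V}
    (hx : x ∈ H.verts) (h : 1 < H.verts.ncard) : ∃ w, IsPick p H x y w := by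
  obtain ⟨w, hw, hmin⟩ := Set.exists_min_image {z | H.Adj x z}
    (fun z => EuclideanGeometry.angle (p y) (p x) (p z)) (Set.toFinite _) (hH.exists_adj hx h)
  exact ⟨w, hw, hmin⟩

end Sides

/-! ### Termination of the recursion -/

section Existence

variable [DecidableEq V] [Finite V] {T : SimpleGraph V}

theorem exists_geometricCycleInCube (p : V → EuclideanSpace ℝ (Fin 2)) (hT : T.IsAcyclic)
    (H : T.Subgraph) (hH : Joined H) (u : Fin 2 → V) (hu : H.Adj (u 0) (u 1)) :
    ∃ M t, GeometricCycleInCube p H u M t := by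
  induction hn : H.verts.ncard using Nat.strong_induction_on generalizing H u with
  | _ n ih =>
    have hsum := ncard_side_add hT hH hu
    have hpos := fun i => ncard_side_pos (H := H) (u := u) i
    have hlt : ∀ i, (side H u i).verts.ncard < n := by
      have h0 := hpos 0
      have h1 := hpos 1
      intro i
      fin_cases i <;> simp only [Fin.zero_eta, Fin.mk_one] <;> omega
    have hside : ∀ i, ∃ w C t Q r,
        (2 < (side H u i).verts.ncard →
          GeometricCycleInCube p (side H u i) ![u i, w] C t) ∧
        LoopBody p (side H u i) (u i) (u i.rev) C t w Q r := by
      intro i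
      rcases (Nat.succ_le_of_lt (hpos i)).eq_or_lt with h1 | h1
      -- No recursive call happens on one or two vertices, so the cycle and its step count are
      -- placeholders.
      · exact ⟨u i, 0, 0, 0, 0, fun h => by omega, .one h1.symm⟩
      · obtain ⟨w, hw⟩ := exists_isPick p (joined_side i) (y := u i.rev)
          (self_mem_side_verts (H := H) (u := u) i) h1
        rcases (Nat.succ_le_of_lt h1).eq_or_lt with h2 | h2
        · exact ⟨w, 0, 0, _, _, fun h => by omega, .two h2.symm hw⟩
        · obtain ⟨M, t, hM⟩ := ih _ (hlt i) _ (joined_side i) ![u i, w] hw.1 rfl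
          exact ⟨w, M, t, _, _, fun _ => hM, .more h2 hw⟩
    choose w C t Q r hcall hbody using hside
    exact ⟨_, _, .mk hu hcall hbody⟩

end Existence

/-! ### Hamiltonian paths as edge multisets -/

section Paths

/-- The edges of the open path that visits the entries of a list in order. -/
def pathEdges : List V → Multiset (Sym2 V)
  | [] => 0
  | [_] => 0
  | a :: b :: l => s(a, b) ::ₘ pathEdges (b :: l)

theorem pathEdges_append (l₁ l₂ : List V) (a b : V) :
    pathEdges (l₁ ++ a :: b :: l₂) =
      pathEdges (l₁ ++ [a]) + {s(a, b)} + pathEdges (b :: l₂) := by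
  induction l₁ with
  | nil => simp [pathEdges]
  | cons c l ih =>
    cases l with
    | nil => simp [pathEdges]
    | cons d l => simpa [pathEdges] using ih

theorem pathEdges_reverse (l : List V) : pathEdges l.reverse = pathEdges l := by
  induction l with
  | nil => rfl
  | cons a l ih =>
    cases l with
    | nil => rfl
    | cons b l =>
      have h := pathEdges_append l.reverse [] b a
      simp only [List.reverse_cons, List.append_assoc, List.cons_append, List.nil_append] at h ih ⊢
      rw [h, ih]
      simp [pathEdges, Sym2.eq_swap, add_comm]

theorem zipWith_cons_append (l : List V) (a b : V) :
    ((List.zipWith (fun a b => s(a, b)) (a :: l) (l ++ [b]) : List (Sym2 V)) :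
      Multiset (Sym2 V)) = pathEdges (a :: l ++ [b]) := by
  induction l generalizing a with
  | nil => rfl
  | cons c l ih => exact congrArg (s(a, c) ::ₘ ·) (ih c)

/-- `Q` is the edge set of a path from `x` to `y` that visits every point of `S` once. -/
def IsHamiltonianPath (S : Set V) (x y : V) (Q : Multiset (Sym2 V)) : Prop :=
  ∃ l : List V, l.Nodup ∧ (∀ v, v ∈ l ↔ v ∈ S) ∧ l.head? = some x ∧ l.getLast? = some y ∧
    pathEdges l = Q

theorem IsHamiltonianPath.refl (x : V) : IsHamiltonianPath {x} x x 0 :=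
  ⟨[x], by simp, by simp, rfl, rfl, rfl⟩

theorem IsHamiltonianPath.pair {x y : V} (h : x ≠ y) :
    IsHamiltonianPath {x, y} x y {s(x, y)} :=
  ⟨[x, y], by simp [h], by simp, rfl, rfl, rfl⟩

theorem IsHamiltonianPath.join {S S' : Set V} {x y x' y' : V} {Q Q' : Multiset (Sym2 V)}
    (h : IsHamiltonianPath S x y Q) (h' : IsHamiltonianPath S' x' y' Q') (hd : Disjoint S S') :
    IsHamiltonianPath (S ∪ S') x x' (Q + {s(y, y')} + Q') := by
  obtain ⟨l, hn, hm, hx, hy, rfl⟩ := h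
  obtain ⟨l', hn', hm', hx', hy', rfl⟩ := h'
  obtain ⟨k, rfl⟩ := List.getLast?_eq_some_iff.1 hy
  obtain ⟨k', rfl⟩ := List.getLast?_eq_some_iff.1 hy'
  -- The second path is traversed backwards, so that `y` meets `y'` and the walk ends at `x'`.
  refine ⟨(k ++ [y]) ++ (k' ++ [y']).reverse, ?_, ?_, ?_, ?_, ?_⟩
  · rw [List.nodup_append]
    refine ⟨hn, List.nodup_reverse.2 hn', fun a ha b hb hab => ?_⟩
    subst hab
    exact Set.disjoint_left.1 hd ((hm a).1 ha) ((hm' a).1 (List.mem_reverse.1 hb))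
  · intro v
    rw [List.mem_append, List.mem_reverse, hm, hm', Set.mem_union]
  · rw [List.head?_append, hx]; rfl
  · rw [List.getLast?_append, List.getLast?_reverse, hx']; rfl
  · rw [← pathEdges_reverse (k' ++ [y'])]
    have := pathEdges_append k k'.reverse y y'
    simpa using this

theorem IsHamiltonianPath.exists_tour {x y : V} {Q : Multiset (Sym2 V)}
    (h : IsHamiltonianPath Set.univ x y Q) :
    ∃ l : List V, IsTour l ∧ tourEdges l = Q + {s(x, y)} := by
  obtain ⟨l, hn, hm, hx, hy, rfl⟩ := h
  refine ⟨l, ⟨hn, fun v => (hm v).2 trivial⟩, ?_⟩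
  obtain ⟨k, rfl⟩ := List.head?_eq_some_iff.1 hx
  rw [tourEdges, List.rotate_cons_succ, List.rotate_zero, zipWith_cons_append]
  obtain ⟨j, hj⟩ := List.getLast?_eq_some_iff.1 hy
  rw [hj, List.append_assoc]
  have := pathEdges_append j [] y x
  simpa [pathEdges, Sym2.eq_swap] using this

theorem IsHamiltonianPath.card {S : Set V} {x y : V} {Q : Multiset (Sym2 V)}
    (h : IsHamiltonianPath S x y Q) : Q.card + 1 = S.ncard := by
  classical
  obtain ⟨l, hn, hm, hx, hy, rfl⟩ := h
  have hS : S = (l.toFinset : Set V) := by ext v; simp [hm]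
  rw [hS, Set.ncard_coe_finset, List.toFinset_card_of_nodup hn]
  obtain ⟨k, rfl⟩ := List.head?_eq_some_iff.1 hx
  clear hn hm hx hy hS
  induction k generalizing x with
  | nil => rfl
  | cons a k ih => simpa [pathEdges] using ih (x := a)

end Paths

/-! ### Correctness and running time -/

section Tour

variable [DecidableEq V] [Finite V] {p : V → EuclideanSpace ℝ (Fin 2)} {T : SimpleGraph V}

theorem LoopBody.isHamiltonianPath {H : T.Subgraph} {x y w : V} {C Q : Multiset (Sym2 V)}
    {t r : ℕ} (h : LoopBody p H x y C t w Q r) (hx : x ∈ H.verts)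
    (hC : 2 < H.verts.ncard → IsHamiltonianPath H.verts x w (C.erase s(x, w))) :
    IsHamiltonianPath H.verts x w Q := by
  cases h with
  | one h =>
    obtain ⟨a, ha⟩ := Set.ncard_eq_one.1 h
    have : x = a := by simpa [ha] using hx
    rw [ha, ← this]
    exact .refl x
  | two h hw =>
    have : ({x, w} : Set V) = H.verts := by
      refine Set.eq_of_subset_of_ncard_le ?_ ?_
      · rintro a (rfl | rfl)
        exacts [hx, hw.1.snd_mem]
      · rw [h, Set.ncard_pair hw.1.ne]
    rw [← this]
    exact .pair hw.1.ne
  | more h hw => exact hC h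

/-- The `+ 1` on the left absorbs half of the two steps charged for adding edges, one per pass. -/
theorem LoopBody.steps_le {H : T.Subgraph} {x y w : V} {C Q : Multiset (Sym2 V)}
    {t r : ℕ} (h : LoopBody p H x y C t w Q r) (hx : x ∈ H.verts)
    (hC : 2 < H.verts.ncard → C.card = H.verts.ncard ∧ t ≤ 3 * H.verts.ncard ^ 2) :
    r + 1 ≤ 3 * H.verts.ncard ^ 2 + 2 * H.verts.ncard := by
  have hdeg : (H.neighborSet x).ncard < H.verts.ncard := by
    refine Set.ncard_lt_ncard ⟨fun a ha => SimpleGraph.Subgraph.Adj.snd_mem ha, fun hs => ?_⟩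
    exact SimpleGraph.Subgraph.Adj.ne (hs hx) rfl
  cases h with
  | one h => omega
  | two h hw => nlinarith
  | more h hw =>
    obtain ⟨h1, h2⟩ := hC h
    omega

/-- A run of the procedure returns a Hamiltonian path of `H` between the ends of the current edge,
together with that edge, within `3 |H|²` steps. -/
theorem GeometricCycleInCube.isHamiltonianPath {H : T.Subgraph} {u : Fin 2 → V}
    {M : Multiset (Sym2 V)} {t : ℕ} (hT : T.IsAcyclic) (hH : Joined H)
    (h : GeometricCycleInCube p H u M t) :
    s(u 0, u 1) ∈ M ∧ IsHamiltonianPath H.verts (u 0) (u 1) (M.erase s(u 0, u 1)) ∧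
      M.card = H.verts.ncard ∧ t ≤ 3 * H.verts.ncard ^ 2 := by
  induction h with
  | @mk H u w C Q t r edge call body ih =>
    have hp : ∀ i, IsHamiltonianPath (side H u i).verts (u i) (w i) (Q i) := fun i =>
      (body i).isHamiltonianPath (self_mem_side_verts i)
        fun h => (ih i h (joined_side i)).2.1
    have hr : ∀ i, r i + 1 ≤ 3 * (side H u i).verts.ncard ^ 2 + 2 * (side H u i).verts.ncard :=
      fun i => (body i).steps_le (self_mem_side_verts i)
        fun h => (ih i h (joined_side i)).2.2
    have hmem : s(u 0, u 1) ∈ Q 0 + {s(u 0, u 1)} + Q 1 + {s(w 0, w 1)} := by simp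
    have herase : (Q 0 + {s(u 0, u 1)} + Q 1 + {s(w 0, w 1)}).erase s(u 0, u 1) =
        Q 0 + {s(w 0, w 1)} + Q 1 := by
      rw [show Q 0 + {s(u 0, u 1)} + Q 1 + {s(w 0, w 1)} =
        s(u 0, u 1) ::ₘ (Q 0 + {s(w 0, w 1)} + Q 1) by
          rw [← Multiset.singleton_add]; abel, Multiset.erase_cons_head]
    have hjoin := (hp 0).join (hp 1) (disjoint_side_verts hT edge)
    rw [side_verts_union hH edge, ← herase] at hjoin
    refine ⟨hmem, hjoin, ?_, ?_⟩
    · rw [← hjoin.card, Multiset.card_erase_add_one hmem]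
    · have hsum := ncard_side_add hT hH edge
      have h0 := ncard_side_pos (H := H) (u := u) 0
      have h1 := ncard_side_pos (H := H) (u := u) 1
      have r0 := hr 0
      have r1 := hr 1
      rw [← hsum]
      generalize (side H u 0).verts.ncard = m at *
      generalize (side H u 1).verts.ncard = n at *
      -- The total is at most `3(m² + n²) + 3(m + n)`, so it remains to see `m + n ≤ 2mn`; this
      -- follows from `(m - 1)(n - 1) ≥ 0` and `mn ≥ 1`.
      have hm : m + n ≤ m * n + 1 := by nlinarith
      nlinarith

end Tour

/-! ### Additivity and monotonicity of weights -/

section Weights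

variable (p : V → EuclideanSpace ℝ (Fin 2))

theorem edgeWeight_nonneg (e : Sym2 V) : 0 ≤ edgeWeight p e := by
  induction e with
  | _ a b => exact sq_nonneg _

theorem edgeWeight_mk (a b : V) : edgeWeight p s(a, b) = ‖p b - p a‖ ^ 2 := by
  rw [← dist_eq_norm, dist_comm]
  rfl

theorem weight_add (M N : Multiset (Sym2 V)) : weight p (M + N) = weight p M + weight p N := by
  simp [weight]

theorem weight_zero : weight p 0 = 0 := rfl

theorem weight_singleton (e : Sym2 V) : weight p {e} = edgeWeight p e := by simp [weight]

theorem weight_erase [DecidableEq V] {M : Multiset (Sym2 V)} {e : Sym2 V} (h : e ∈ M) :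
    weight p (M.erase e) = weight p M - edgeWeight p e := by
  conv_rhs => rw [← Multiset.cons_erase h, ← Multiset.singleton_add, weight_add, weight_singleton]
  ring

variable [Fintype V]

theorem graphWeight_nonneg (G : SimpleGraph V) : 0 ≤ graphWeight p G :=
  Finset.sum_nonneg fun e _ => edgeWeight_nonneg p e

theorem edgeWeight_le_graphWeight {G : SimpleGraph V} {a b : V} (h : G.Adj a b) :
    edgeWeight p s(a, b) ≤ graphWeight p G := by
  classical
  exact Finset.single_le_sum (f := edgeWeight p) (fun e _ => edgeWeight_nonneg p e)
    (SimpleGraph.mem_edgeFinset.2 h)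

theorem graphWeight_le_weight {G : SimpleGraph V} {M : Multiset (Sym2 V)}
    (h : ∀ e ∈ G.edgeSet, e ∈ M) : graphWeight p G ≤ weight p M := by
  classical
  have hle : G.edgeFinset.val ≤ M :=
    (Multiset.le_iff_subset G.edgeFinset.nodup).2
      fun e he => h e (SimpleGraph.mem_edgeFinset.1 he)
  obtain ⟨N, rfl⟩ := Multiset.le_iff_exists_add.1 hle
  have hN : 0 ≤ weight p N := Multiset.sum_nonneg fun x hx => by
    obtain ⟨e, -, rfl⟩ := Multiset.mem_map.1 hx
    exact edgeWeight_nonneg p e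
  have hG : graphWeight p G = weight p G.edgeFinset.val := by
    unfold graphWeight weight Finset.sum
    congr!
  rw [weight_add, hG]
  linarith

theorem graphWeight_sides_le {T : SimpleGraph V} {H : T.Subgraph} {u : Fin 2 → V}
    (hT : T.IsAcyclic) (hu : H.Adj (u 0) (u 1)) :
    graphWeight p (side H u 0).spanningCoe + graphWeight p (side H u 1).spanningCoe +
      edgeWeight p s(u 0, u 1) ≤ graphWeight p H.spanningCoe := by
  classical
  unfold graphWeight
  have hd : Disjoint (side H u 0).spanningCoe.edgeFinset
      (side H u 1).spanningCoe.edgeFinset := by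
    rw [Finset.disjoint_left]
    intro e h0 h1
    induction e with
    | _ a b =>
      rw [SimpleGraph.mem_edgeFinset] at h0 h1
      exact Set.disjoint_left.1 (disjoint_side_verts hT hu)
        (SimpleGraph.Subgraph.Adj.fst_mem h0) (SimpleGraph.Subgraph.Adj.fst_mem h1)
  have hne : ∀ i, s(u 0, u 1) ∉ (side H u i).spanningCoe.edgeFinset := by
    intro i h
    rw [SimpleGraph.mem_edgeFinset] at h
    exact (side_adj.1 h).2.2.2 rfl
  rw [← Finset.sum_union hd, ← Finset.sum_singleton (edgeWeight p) s(u 0, u 1),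
    ← Finset.sum_union]
  · refine Finset.sum_le_sum_of_subset_of_nonneg ?_ fun e _ _ => edgeWeight_nonneg p e
    have hs : ∀ i, (side H u i).spanningCoe.edgeFinset ⊆ H.spanningCoe.edgeFinset := by
      intro i
      refine SimpleGraph.edgeFinset_mono fun a b h => ?_
      exact (side_adj.1 h).2.2.1
    refine Finset.union_subset (Finset.union_subset (hs 0) (hs 1)) ?_
    rw [Finset.singleton_subset_iff, SimpleGraph.mem_edgeFinset]
    exact hu
  · rw [Finset.disjoint_singleton_right, Finset.mem_union]
    exact fun h => h.elim (hne 0) (hne 1)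

end Weights

/-! ### The factor 5 -/

section Geometry

open InnerProductGeometry

theorem inner_nonpos_of_angle_le {E : Type*} [NormedAddCommGroup E] [InnerProductSpace ℝ E]
    {x y z : E} (h : inner ℝ x y < 0) (hle : angle x y ≤ angle x z) : inner ℝ x z ≤ 0 := by
  have h1 : Real.cos (angle x z) ≤ Real.cos (angle x y) :=
    Real.cos_le_cos_of_nonneg_of_le_pi (angle_nonneg _ _) (angle_le_pi _ _) hle
  have h2 : Real.cos (angle x y) ≤ 0 := by
    rw [cos_angle]
    exact div_nonpos_of_nonpos_of_nonneg h.le (by positivity)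
  rw [← cos_angle_mul_norm_mul_norm]
  exact mul_nonpos_of_nonpos_of_nonneg (h1.trans h2) (by positivity)

variable {T : SimpleGraph V}

/-- `s` is a sum of the vector from `x` to `y` and of vectors along other edges of `H` at `x`, in
the weak sense that is needed: in any direction with nonpositive components along these other edges,
the component of `s` is at most that of the edge `x y`. -/
def Dominated (p : V → EuclideanSpace ℝ (Fin 2)) (H : T.Subgraph) (x y : V)
    (s : EuclideanSpace ℝ (Fin 2)) : Prop :=
  ∀ g : EuclideanSpace ℝ (Fin 2),
    (∀ z, H.Adj x z → z ≠ y → inner ℝ g (p z - p x) ≤ 0) →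
      inner ℝ g s ≤ inner ℝ g (p y - p x)

variable [DecidableEq V] {p : V → EuclideanSpace ℝ (Fin 2)}

/-- Of the two copies of `‖p w - p x‖²`, in the recursive case one is the slack of the returned
cycle and the other is the edge removed from it. The small cases meet the same bound directly. -/
theorem LoopBody.weight_le [Fintype V] {H : T.Subgraph} {x y w : V} {C Q : Multiset (Sym2 V)}
    {t r : ℕ} (h : LoopBody p H x y C t w Q r)
    (hC : 2 < H.verts.ncard → ∃ s, Dominated p H x w s ∧
      weight p (C.erase s(x, w)) ≤
        5 * graphWeight p H.spanningCoe - 2 * ‖p w - p x‖ ^ 2 - ‖s‖ ^ 2) :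
    ∃ s, Dominated p H x w s ∧
      weight p Q ≤ 5 * graphWeight p H.spanningCoe - 2 * ‖p w - p x‖ ^ 2 - ‖s‖ ^ 2 := by
  cases h with
  | one h =>
    -- For a single vertex `w = x`, so the edge vector and `s` are both zero.
    refine ⟨p x - p x, fun g _ => le_rfl, ?_⟩
    have := graphWeight_nonneg p H.spanningCoe
    simpa [weight_zero] using this
  | two h hw =>
    refine ⟨p w - p x, fun g _ => le_rfl, ?_⟩
    have h1 := edgeWeight_le_graphWeight p (G := H.spanningCoe) hw.1
    have h2 := graphWeight_nonneg p H.spanningCoe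
    rw [edgeWeight_mk] at h1
    rw [weight_singleton, edgeWeight_mk]
    linarith
  | more h hw => exact hC h

/-- The edge `x y` is put in front of the greedy sequence of edges at `x` in the component `H'`. -/
theorem LoopBody.exists_dominated {H H' : T.Subgraph} {x y w : V} {C Q : Multiset (Sym2 V)}
    {t r : ℕ} (h : LoopBody p H' x y C t w Q r)
    (hadj : ∀ z, H'.Adj x z ↔ H.Adj x z ∧ z ≠ y)
    {s : EuclideanSpace ℝ (Fin 2)} (hs : Dominated p H' x w s) :
    ∃ S, Dominated p H x y S ∧
      ‖S‖ ^ 2 ≤ ‖s‖ ^ 2 + 2 * inner ℝ (p y - p x) (p w - p x) + ‖p y - p x‖ ^ 2 := by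
  rcases lt_or_ge (inner ℝ (p y - p x) (p w - p x)) 0 with hneg | hnn
  · have hw : IsPick p H' x y w := by
      cases h with
      | one h => simp at hneg
      | two h hw => exact hw
      | more h hw => exact hw
    refine ⟨p y - p x + s, fun g hg => ?_, ?_⟩
    · have h1 := hs g fun z hz _ => hg z ((hadj z).1 hz).1 ((hadj z).1 hz).2
      have h2 := hg w ((hadj w).1 hw.1).1 ((hadj w).1 hw.1).2
      rw [inner_add_right]
      linarith
    -- The smallest angle is obtuse, so every edge of `H'` at `x` has nonpositive component along `x
    -- y`, which is thus an admissible test direction for `s`.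
    · have h1 := hs (p y - p x) fun z hz _ => inner_nonpos_of_angle_le hneg (hw.2 z hz)
      rw [norm_add_sq_real]
      linarith
  -- Without an obtuse turn the sum restarts at the edge `x y` alone.
  · refine ⟨p y - p x, fun g _ => le_rfl, ?_⟩
    have := sq_nonneg ‖s‖
    linarith

/-- The right side exceeds the left by exactly `‖(b - v) + (a - u)‖²`. -/
theorem norm_sq_shortcut_le {E : Type*} [NormedAddCommGroup E] [InnerProductSpace ℝ E]
    (u v a b : E) :
    ‖b - a‖ ^ 2 ≤ ‖v - u‖ ^ 2 + 2 * ‖a - u‖ ^ 2 + 2 * ‖b - v‖ ^ 2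
      - 2 * inner ℝ (v - u) (a - u) - 2 * inner ℝ (u - v) (b - v) := by
  have h1 : b - a = (v - u) + ((b - v) - (a - u)) := by abel
  have h2 : u - v = -(v - u) := by abel
  have h3 := sq_nonneg ‖(b - v) + (a - u)‖
  rw [h1, h2, norm_add_sq_real, norm_sub_sq_real (b - v), inner_sub_right, inner_neg_left]
  rw [norm_add_sq_real] at h3
  linarith

/-- The weight of the returned cycle, with the slack at both ends of the current edge that the
induction needs. -/
theorem GeometricCycleInCube.weight_le_sub [Fintype V] {H : T.Subgraph} {u : Fin 2 → V}
    {M : Multiset (Sym2 V)} {t : ℕ} (hT : T.IsAcyclic)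
    (h : GeometricCycleInCube p H u M t) :
    s(u 0, u 1) ∈ M ∧ ∃ s₀ s₁, Dominated p H (u 0) (u 1) s₀ ∧ Dominated p H (u 1) (u 0) s₁ ∧
      weight p M ≤ 5 * graphWeight p H.spanningCoe - ‖p (u 1) - p (u 0)‖ ^ 2
        - ‖s₀‖ ^ 2 - ‖s₁‖ ^ 2 := by
  induction h with
  | @mk H u w C Q t r edge call body ih =>
    refine ⟨by simp, ?_⟩
    have hQ : ∀ i, ∃ s, Dominated p (side H u i) (u i) (w i) s ∧
        weight p (Q i) ≤ 5 * graphWeight p (side H u i).spanningCoe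
          - 2 * ‖p (w i) - p (u i)‖ ^ 2 - ‖s‖ ^ 2 := by
      refine fun i => (body i).weight_le fun h => ?_
      obtain ⟨hmem, s₀, s₁, hd, -, hle⟩ := ih i h
      refine ⟨s₀, hd, ?_⟩
      simp only [Matrix.cons_val_zero, Matrix.cons_val_one] at hmem hle
      rw [weight_erase p hmem, edgeWeight_mk]
      have := sq_nonneg ‖s₁‖
      linarith
    choose s hs hle using hQ
    have hS : ∀ i, ∃ S, Dominated p H (u i) (u i.rev) S ∧
        ‖S‖ ^ 2 ≤ ‖s i‖ ^ 2 + 2 * inner ℝ (p (u i.rev) - p (u i)) (p (w i) - p (u i))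
          + ‖p (u i.rev) - p (u i)‖ ^ 2 :=
      fun i => (body i).exists_dominated (fun z => side_adj_self i edge.ne) (hs i)
    obtain ⟨S₀, hd₀, hS₀⟩ := hS 0
    obtain ⟨S₁, hd₁, hS₁⟩ := hS 1
    have hr0 : (0 : Fin 2).rev = 1 := rfl
    have hr1 : (1 : Fin 2).rev = 0 := rfl
    rw [hr0] at hd₀ hS₀
    rw [hr1] at hd₁ hS₁
    refine ⟨S₀, S₁, hd₀, hd₁, ?_⟩
    have hg := graphWeight_sides_le p hT edge
    have hshort := norm_sq_shortcut_le (p (u 0)) (p (u 1)) (p (w 0)) (p (w 1))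
    have hle₀ := hle 0
    have hle₁ := hle 1
    rw [norm_sub_rev (p (u 0)) (p (u 1))] at hS₁
    rw [edgeWeight_mk] at hg
    simp only [weight_add, weight_singleton, edgeWeight_mk]
    -- The current edge is counted four times: once itself, once in the shortcut bound, and once in
    -- each of `hS₀`, `hS₁`. The fifth copy in `5 w(H)` is the slack.
    linarith

theorem GeometricCycleInCube.weight_le [Fintype V] {H : T.Subgraph} {u : Fin 2 → V}
    {M : Multiset (Sym2 V)} {t : ℕ} (hT : T.IsAcyclic)
    (h : GeometricCycleInCube p H u M t) :
    weight p M ≤ 5 * graphWeight p H.spanningCoe := by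
  obtain ⟨-, s₀, s₁, -, -, hle⟩ := h.weight_le_sub hT
  have h1 := sq_nonneg ‖s₀‖
  have h2 := sq_nonneg ‖s₁‖
  have h3 := sq_nonneg ‖p (u 1) - p (u 0)‖
  linarith

end Geometry

/-! ### Spanning trees against tours -/

section SpanningTrees

variable (p : V → EuclideanSpace ℝ (Fin 2))

theorem exists_isMST [Fintype V] [Nonempty V] : ∃ T : SimpleGraph V, IsMST p T := by
  obtain ⟨T₀, -, hT₀⟩ := (SimpleGraph.connected_top (V := V)).exists_isTree_le
  obtain ⟨T, hT, hmin⟩ := Set.exists_min_image {T : SimpleGraph V | T.IsTree} (graphWeight p)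
    (Set.toFinite _) ⟨T₀, hT₀⟩
  exact ⟨T, hT, hmin⟩

theorem reachable_of_mem_pathEdges {G : SimpleGraph V} (x : V) (l : List V)
    (h : ∀ e ∈ pathEdges (x :: l), ∀ a b, e = s(a, b) → G.Reachable a b) :
    ∀ v ∈ x :: l, G.Reachable x v := by
  induction l generalizing x with
  | nil => simp
  | cons y l ih =>
    have hxy : G.Reachable x y := h s(x, y) (by simp [pathEdges]) x y rfl
    intro v hv
    rcases List.mem_cons.1 hv with rfl | hv
    · exact .refl _
    · exact hxy.trans (ih y (fun e he => h e (by simp [pathEdges, he])) v hv)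

/-- A tour is at least as heavy as a minimum spanning tree. -/
theorem IsMST.graphWeight_le_tour [Fintype V] {T : SimpleGraph V} (hT : IsMST p T) {l : List V}
    (hl : IsTour l) : graphWeight p T ≤ weight p (tourEdges l) := by
  obtain ⟨v⟩ := hT.1.connected.nonempty
  obtain ⟨x, k, rfl⟩ := List.exists_cons_of_ne_nil (List.ne_nil_of_mem (hl.2 v))
  have htour : tourEdges (x :: k) = pathEdges (x :: k ++ [x]) := by
    rw [tourEdges, List.rotate_cons_succ, List.rotate_zero, zipWith_cons_append]
  let G : SimpleGraph V := .fromEdgeSet {e | e ∈ tourEdges (x :: k)}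
  have hreach : ∀ v, G.Reachable x v := by
    intro v
    refine reachable_of_mem_pathEdges (G := G) x (k ++ [x]) ?_ v (by
      have := hl.2 v
      simp only [List.mem_cons, List.mem_append] at this ⊢
      tauto)
    rintro e he a b rfl
    -- A one-city tour consists of a loop, which `fromEdgeSet` discards.
    by_cases hab : a = b
    · rw [hab]
    · refine SimpleGraph.Adj.reachable ((SimpleGraph.fromEdgeSet_adj _).2 ⟨?_, hab⟩)
      rw [Set.mem_ofPred_eq, htour]
      exact he
  have hG : G.Connected :=
    { preconnected := fun a b => (hreach a).symm.trans (hreach b), nonempty := ⟨x⟩ }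
  obtain ⟨T', hle, hT'⟩ := hG.exists_isTree_le
  refine (hT.2 T' hT').trans (graphWeight_le_weight p fun e he => ?_)
  have := SimpleGraph.edgeSet_mono hle he
  rw [SimpleGraph.edgeSet_fromEdgeSet] at this
  exact this.1

end SpanningTrees

end TSPSquared

theorem mainTheorem1 {V : Type*} [Fintype V] [DecidableEq V]
    (p : V → EuclideanSpace ℝ (Fin 2)) (hp : Function.Injective p)
    (hV : 2 ≤ Fintype.card V) :
    (∃ T : SimpleGraph V, TSPSquared.IsMST p T) ∧
    ∀ T : SimpleGraph V, TSPSquared.IsMST p T →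
      (∃ u : Fin 2 → V, T.Adj (u 0) (u 1)) ∧
      ∀ u : Fin 2 → V, T.Adj (u 0) (u 1) →
        (∃ (M : Multiset (Sym2 V)) (t : ℕ),
          TSPSquared.GeometricCycleInCube p (⊤ : T.Subgraph) u M t) ∧
        ∀ (M : Multiset (Sym2 V)) (t : ℕ),
          TSPSquared.GeometricCycleInCube p (⊤ : T.Subgraph) u M t →
            (∃ l : List V, TSPSquared.IsTour l ∧ TSPSquared.tourEdges l = M) ∧
            TSPSquared.weight p M ≤ 5 * TSPSquared.graphWeight p T ∧
            (∀ l : List V, TSPSquared.IsTour l →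
              TSPSquared.weight p M ≤ 5 * TSPSquared.weight p (TSPSquared.tourEdges l)) ∧
            t ≤ 3 * Fintype.card V ^ 2 := by
  have : Nontrivial V := Fintype.one_lt_card_iff_nontrivial.1 hV
  refine ⟨TSPSquared.exists_isMST p, fun T hT => ?_⟩
  have hjoined : TSPSquared.Joined (⊤ : T.Subgraph) := fun x _ y _ => by
    rw [SimpleGraph.Subgraph.spanningCoe_top]
    exact hT.1.connected x y
  have hcard : (⊤ : T.Subgraph).verts.ncard = Fintype.card V := by
    rw [SimpleGraph.Subgraph.verts_top, Set.ncard_univ, Nat.card_eq_fintype_card]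
  refine ⟨?_, fun u hu => ⟨?_, fun M t h => ?_⟩⟩
  · obtain ⟨x⟩ := hT.1.connected.nonempty
    obtain ⟨y, hy⟩ := hjoined.exists_adj (x := x) trivial (by rw [hcard]; exact hV)
    exact ⟨![x, y], hy⟩
  · exact TSPSquared.exists_geometricCycleInCube p hT.1.isAcyclic ⊤ hjoined u hu
  · obtain ⟨hmem, hpath, -, ht⟩ := h.isHamiltonianPath hT.1.isAcyclic hjoined
    have hw := h.weight_le hT.1.isAcyclic
    rw [SimpleGraph.Subgraph.spanningCoe_top] at hw
    rw [SimpleGraph.Subgraph.verts_top] at hpath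
    refine ⟨?_, hw, fun l hl => ?_, hcard ▸ ht⟩
    · obtain ⟨l, hl, hle⟩ := hpath.exists_tour
      refine ⟨l, hl, ?_⟩
      rw [hle, add_comm, Multiset.singleton_add, Multiset.cons_erase hmem]
    · have := hT.graphWeight_le_tour p hl
      linarith
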